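/- **Setting.** A mean-payoff bidding game is a finite directed graph $(V,E)$ in which every vertex has a successor, with weights $w:V\to\mathbb Z$. A token is placed on a vertex. Two players, Min and Max, have budgets in $[0,1]$ whose sum is $1$. In each round both simultaneously submit a bid between $0$ and their budget and name a successor of the current vertex; the player with the higher bid pays his bid to the other player and moves the token to the successor he named. Ties are resolved by an arbitrary fixed tie-breaking mechanism (a function of the history and of the two actions). A strategy maps histories to actions; it is legal for an initial budget if it never bids above the current budget and always names a successor, from every initial vertex and against every opponent who keeps to these rules. The value of an outcome $v_0,v_1,\dots$ is $\liminf_{n\to\infty}\frac1n\sum_{i<n}w(v_i)$, and the energy after $n$ rounds is $\sum_{i<n}w(v_i)$. A threshold budget at $v$ is a $t\in[0,1]$ such that, starting at $v$, Min has a legal strategy guaranteeing a non-positive value whenever his initial budget exceeds $t$, and Max has a legal strategy guaranteeing a strictly positive value whenever his initial budget exceeds $1-t$. A strategy with $n$ memory states, constructed for a given initial vertex and initial budget, is of the following form. In each memory state and at each vertex it names a fixed successor, and its bid is a function, with values in $[0,1]$, of the current budget and energy only; this function is *simple*, i.e. a selection between at most $k$ polynomials in budget and energy, where the selection is made by polynomial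 inequalities. The memory state is updated after each round according to the previous state and the new vertex, budget and energy. The strategy is memoryless if $n=1$. A strongly connected graph is recurrent if some vertex lies on all its cycles. **Theorem.** There is an absolute constant $K$ such that the following holds for every mean-payoff bidding game, every tie-breaking mechanism and every vertex $v$. There is exactly one threshold budget $\mathrm{Thresh}(v)$ at $v$. If Max's initial budget $B\le 1$ satisfies $B>1-\mathrm{Thresh}(v)$, then Max has a legal strategy with constant memory ($K$ memory states, each bid function a selection between at most $K$ polynomials) that guarantees a strictly positive mean-payoff value from $v$: there is $\mu>0$ such that every outcome has value at least $\mu$, against every opponent who keeps to the rules. If moreover the graph is strongly connected and recurrent, then Max has a memoryless such strategy (with the same bound $K$ on the number of polynomials). -/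

import Mathlib

namespace Bidding

/-- The two players of a mean-payoff bidding game. -/
inductive Player
  | min
  | max
  deriving DecidableEq

/-- A mean-payoff game arena: a directed graph without dead ends (so that outcomes are infinite),
with integer weights on the vertices. -/
structure Game (V : Type*) where
  Adj : V → V → Prop
  weight : V → ℤ
  exists_adj : ∀ v, ∃ u, Adj v u

/-- A history `v₀, ⟨v₁, b₁, i₁⟩, …, ⟨vₖ, bₖ, iₖ⟩`: `round h v b i` extends `h` by a bidding that
player `i` wins with the bid `b`, after which he moves the token to `v`. -/
inductive History (V : Type*)
  | start (v : V) : History V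
  | round (h : History V) (v : V) (b : ℝ) (i : Player) : History V

/-- An action `⟨b, u⟩`: a bid and the vertex to move to upon winning. -/
structure Action (V : Type*) where
  bid : ℝ
  move : V

abbrev Strategy (V : Type*) := History V → Action V

/-- A tie-breaking mechanism: who wins when the bids are equal, as a function of the history and of
the actions of Min and of Max (in this order). -/
abbrev TieBreak (V : Type*) := History V → Action V → Action V → Player

namespace History

variable {V : Type*}

/-- The vertex that carries the token. -/
def last : History V → V
  | start v => v
  | round _ v _ _ => v

/-- The total payment of player `P`; a payment he receives counts negatively. -/
def payment (P : Player) : History V → ℝ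
  | start _ => 0
  | round h _ b i => payment P h + (if i = P then b else -b)

/-- The energy: the sum of the weights of all the vertices of the history but the last one, so that
after `n` rounds it is `w(v₀) + ⋯ + w(vₙ₋₁)`. -/
def energy (G : Game V) : History V → ℤ
  | start _ => 0
  | round h _ _ _ => energy G h + G.weight h.last

end History

/-- The initial budgets of both players when player `P` starts with `b`. -/
def initialBudget (P : Player) (b : ℝ) (Q : Player) : ℝ :=
  if Q = P then b else 1 - b

/-- The budget of player `Q` after the history `h`, when player `P` starts with `b`. -/
def budget {V : Type*} (P : Player) (b : ℝ) (Q : Player) (h : History V) : ℝ :=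
  initialBudget P b Q - h.payment Q

open Classical in
/-- The history after one more bidding, in which Min and Max take the actions `x` and `y`. -/
noncomputable def step {V : Type*} (τ : TieBreak V) (h : History V) (x y : Action V) : History V :=
  if y.bid < x.bid then h.round x.move x.bid Player.min
  else if x.bid < y.bid then h.round y.move y.bid Player.max
  else match τ h x y with
    | Player.min => h.round x.move x.bid Player.min
    | Player.max => h.round y.move y.bid Player.max

/-- The prefix with `n` rounds of the outcome from `v` when each player `Q` plays `σ Q`. -/
noncomputable def outcome {V : Type*} (τ : TieBreak V) (v : V) (σ : Player → Strategy V) :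
    ℕ → History V
  | 0 => History.start v
  | n + 1 =>
    step τ (outcome τ v σ n) (σ Player.min (outcome τ v σ n)) (σ Player.max (outcome τ v σ n))

/-- Player `P` plays `f`, his opponent plays `g`. -/
def profile {V : Type*} (P : Player) (f g : Strategy V) : Player → Strategy V :=
  fun Q => if Q = P then f else g

namespace Game

variable {V : Type*} (G : Game V)

/-- After the history `h`, player `Q` may take the action `a` (player `P` started with `b`):
the bid is covered by the budget of `Q`, and the move is along an edge. -/
def Permitted (P : Player) (b : ℝ) (Q : Player) (h : History V) (a : Action V) : Prop :=
  0 ≤ a.bid ∧ a.bid ≤ budget P b Q h ∧ G.Adj h.last a.move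

/-- The strategy `f` is legal for player `P` with respect to his initial budget `b`: from every
initial vertex and against every strategy of the opponent, as long as the opponent keeps to the
rules, `f` takes a permitted action. -/
def Legal (τ : TieBreak V) (P : Player) (b : ℝ) (f : Strategy V) : Prop :=
  ∀ (v₀ : V) (g : Strategy V) (n : ℕ),
    (∀ Q, Q ≠ P → ∀ k < n, G.Permitted P b Q (outcome τ v₀ (profile P f g) k)
      (g (outcome τ v₀ (profile P f g) k))) →
    G.Permitted P b P (outcome τ v₀ (profile P f g) n) (f (outcome τ v₀ (profile P f g) n))

/-- The mean-payoff value `lim inf E(πⁿ) / n` of an outcome `π`. -/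
noncomputable def meanPayoff (π : ℕ → History V) : ℝ :=
  Filter.liminf (fun n : ℕ => ((π n).energy G : ℝ) / (n : ℝ)) Filter.atTop

/-- The strategy `f`, played by `P` from `v` with initial budget `b`, is legal, and against every
strategy of the opponent that keeps to the rules, the mean-payoff value of the outcome is in `S`. -/
def Guarantees (τ : TieBreak V) (P : Player) (b : ℝ) (v : V) (f : Strategy V) (S : Set ℝ) : Prop :=
  G.Legal τ P b f ∧
    ∀ g : Strategy V,
      (∀ Q, Q ≠ P → ∀ n, G.Permitted P b Q (outcome τ v (profile P f g) n)
        (g (outcome τ v (profile P f g) n))) →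
      G.meanPayoff (outcome τ v (profile P f g)) ∈ S

/-- `t` is a threshold budget at `v`: with a budget above `t` Min can guarantee a non-positive
value, and with a budget above `1 - t` Max can guarantee a strictly positive value. -/
def IsThreshold (τ : TieBreak V) (v : V) (t : ℝ) : Prop :=
  t ∈ Set.Icc (0 : ℝ) 1 ∧
  (∀ b : ℝ, t < b → b ≤ 1 →
    ∃ f : Strategy V, G.Guarantees τ Player.min b v f (Set.Iic 0)) ∧
  (∀ b : ℝ, 1 - t < b → b ≤ 1 →
    ∃ f : Strategy V, G.Guarantees τ Player.max b v f (Set.Ioi 0))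

/-- The graph is strongly connected and recurrent: some root `u` lies on every cycle. -/
def RecurrentSCC : Prop :=
  (∀ a b, Relation.ReflTransGen G.Adj a b) ∧
  ∃ u, ∀ a, ¬ Relation.TransGen (fun x y => G.Adj x y ∧ x ≠ u ∧ y ≠ u) a a

end Game

/-- `IsSelection k φ`: the function `φ` of the budget `x` and the energy `e` is a selection between
`k` polynomials, where the selection is made by comparisons of polynomials in `x` and `e`. -/
inductive IsSelection : ℕ → (ℝ → ℝ → ℝ) → Prop
  | poly (p : MvPolynomial (Fin 2) ℝ) : IsSelection 1 (fun x e => MvPolynomial.eval ![x, e] p)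
  | select (m n : ℕ) (p : MvPolynomial (Fin 2) ℝ) (φ ψ χ : ℝ → ℝ → ℝ)
      (hφ : IsSelection m φ) (hψ : IsSelection n ψ)
      (hpos : ∀ x e, 0 ≤ MvPolynomial.eval ![x, e] p → χ x e = φ x e)
      (hneg : ∀ x e, MvPolynomial.eval ![x, e] p < 0 → χ x e = ψ x e) :
      IsSelection (m + n) χ

/-- A strategy with `n` memory states. In each memory state and at each vertex, the vertex to move
to upon winning is fixed, and the bid depends only on the current budget and energy, as a
selection between at most `k` polynomials. After each round the memory state is updated according
to the new vertex, budget and energy. With `n = 1` this is a memoryless strategy. -/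
structure MemoryStrategy {V : Type*} (G : Game V) (n k : ℕ) where
  init : Fin n
  update : Fin n → V → ℝ → ℤ → Fin n
  move : Fin n → V → V
  move_adj : ∀ m v, G.Adj v (move m v)
  bid : Fin n → V → ℝ → ℝ → ℝ
  bid_mem : ∀ m v, ∀ x ∈ Set.Icc (0 : ℝ) 1, ∀ e : ℤ, bid m v x e ∈ Set.Icc (0 : ℝ) 1
  bid_simple : ∀ m v, ∃ j ≤ k, IsSelection j (bid m v)

namespace MemoryStrategy

variable {V : Type*} {G : Game V} {n k : ℕ}

/-- The memory state after a history, for player `P` with initial budget `b`. -/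
noncomputable def state (s : MemoryStrategy G n k) (P : Player) (b : ℝ) : History V → Fin n
  | History.start _ => s.init
  | History.round h v c i =>
    s.update (state s P b h) v (budget P b P (History.round h v c i))
      ((History.round h v c i).energy G)

/-- The strategy that `s` implements for player `P` with initial budget `b`. -/
noncomputable def toStrategy (s : MemoryStrategy G n k) (P : Player) (b : ℝ) : Strategy V :=
  fun h =>
    { bid := s.bid (s.state P b h) h.last (budget P b P h) (h.energy G : ℝ)
      move := s.move (s.state P b h) h.last }

end MemoryStrategy

end Bidding

/-!
Consider the random-turn game in which a fair coin decides who moves. On a bottom strongly connected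
component it has a value `c` and a potential `h`, with `h v + c = w v + (max h + min h) / 2` over the
successors of `v` (`exists_potential`). Let `t` be `1` on the components with `c > 0`, `0` on the
other ones, and elsewhere the mean of its extreme values on the successors
(`exists_threshold_function`). This `t` is the threshold budget.

Let `θ` be the threshold of a player (`t` for Min, `1 - t` for Max), and let him have the budget
`x = θ v + δ` with `δ > 0`. If he bids `θ v - θ v⁻`, where `v⁻` is a successor with least `θ`, the
excess `δ` never decreases. On top of this he bids a part of `δ`. A single potential `Q` on the whole
graph measures the progress: on the components that the player wants to reach it is `h`, and elsewhere
it grows so fast towards them that reaching them outweighs every weight (`exists_guide`). With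
`X = energy + Q` (with the opposite energy for Min), a round changes `X` by the drift plus or minus
some `s ≥ 0`, and the bid `θ v - θ v⁻ + a s δ` changes `δ` by the factor `1 - a s` upon winning and by
at least the factor `1 + a s` upon losing. Moves of the opponent that do not maximize `θ` increase `δ`
by a constant, which makes up for what they cost in `X` (`Guide.round_cases`).

* Max has a positive drift `c`. For a small constant `a`, `δ * exp (a X)` grows exponentially; since
  `δ ≤ 1`, the energy grows linearly (`Guide.exists_guarantees_max`). The bid is a polynomial in the
  budget, clamped to the interval from `0` to the budget, and needs no memory, so that recurrence of
  the graph plays no role.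
* Min has no drift. With `a = 1 / (A - X)` when `X < 0`, the quotient `δ / (A - X)` does not decrease.
  So either `X` is nonnegative infinitely often, or it is bounded from below; in both cases the energy
  is below a constant infinitely often (`Guide.exists_guarantees_min`).

The threshold is unique since two different ones would allow both players to win at once
(`Guarantees.inter_nonempty`).
-/

/-! ### The random-turn game: potentials and thresholds -/

namespace Bidding

section FiniteFamilies

variable {ι : Type*} [Finite ι]

theorem exists_forall_abs_le (f : ι → ℝ) : ∃ C : ℝ, 0 ≤ C ∧ ∀ i, |f i| ≤ C := by
  obtain ⟨C, hC⟩ := (Set.finite_range fun i => |f i|).bddAbove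
  exact ⟨max C 0, le_max_right _ _, fun i => (hC ⟨i, rfl⟩).trans (le_max_left _ _)⟩

/-- The positive members of a finite family are bounded away from zero. -/
theorem exists_pos_forall_le (f : ι → ℝ) : ∃ ε : ℝ, 0 < ε ∧ ∀ i, 0 < f i → ε ≤ f i := by
  rcases isEmpty_or_nonempty ι with _ | _
  · exact ⟨1, one_pos, fun i => isEmptyElim i⟩
  · obtain ⟨j, hj⟩ := Finite.exists_min fun i => if 0 < f i then f i else 1
    refine ⟨if 0 < f j then f j else 1, by split_ifs <;> linarith, fun i hi => ?_⟩
    simpa [hi] using hj i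

end FiniteFamilies

namespace Game

variable {V : Type*} (G : Game V)

/-- The vertex `u` can be reached from `v` along edges (in any number of steps). -/
def Reach (v u : V) : Prop := Relation.ReflTransGen G.Adj v u

/-- The vertex `v` lies in a bottom strongly connected component: it can be reached again from
whatever can be reached from it. -/
def IsBottom (v : V) : Prop := ∀ u, G.Reach v u → G.Reach u v

/-- `r` is the mean of the least and of the greatest value of `f` on the successors of `v`. -/
def IsMean (f : V → ℝ) (v : V) (r : ℝ) : Prop :=
  ∃ x y, G.Adj v x ∧ G.Adj v y ∧ (∀ u, G.Adj v u → f x ≤ f u ∧ f u ≤ f y) ∧ r = (f x + f y) / 2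

variable {G}

theorem IsMean.le_add {f f' : V → ℝ} {v : V} {r r' ε : ℝ} (h : G.IsMean f v r)
    (h' : G.IsMean f' v r') (hle : ∀ u, G.Adj v u → f u ≤ f' u + ε) : r ≤ r' + ε := by
  obtain ⟨x, y, hx, hy, hu, rfl⟩ := h
  obtain ⟨x', y', hx', hy', hu', rfl⟩ := h'
  linarith [hle x' hx', hle y hy, (hu x' hx').1, (hu' y hy).2]

theorem IsMean.const_sub {f : V → ℝ} {v : V} {r : ℝ} (h : G.IsMean f v r) (k : ℝ) :
    G.IsMean (fun u => k - f u) v (k - r) := by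
  obtain ⟨x, y, hx, hy, hu, rfl⟩ := h
  refine ⟨y, x, hy, hx, fun u h => ⟨?_, ?_⟩, by ring⟩
  · linarith [(hu u h).2]
  · linarith [(hu u h).1]

theorem IsMean.congr {f f' : V → ℝ} {v : V} {r : ℝ} (h : G.IsMean f v r)
    (hf : ∀ u, G.Adj v u → f' u = f u) : G.IsMean f' v r := by
  obtain ⟨x, y, hx, hy, hu, rfl⟩ := h
  refine ⟨x, y, hx, hy, fun u h => ?_, by rw [hf x hx, hf y hy]⟩
  rw [hf x hx, hf y hy, hf u h]
  exact hu u h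

theorem Reach.mono_bottom {v u : V} (hv : G.IsBottom v) (h : G.Reach v u) : G.IsBottom u :=
  fun _ hx => (hv _ (h.trans hx)).trans h

section Finite

variable [Finite V]

variable (G) in
theorem exists_isMean (f : V → ℝ) (v : V) : ∃ r, G.IsMean f v r := by
  obtain ⟨u₀, hu₀⟩ := G.exists_adj v
  obtain ⟨x, hx, hx'⟩ := Set.exists_min_image {u | G.Adj v u} f (Set.toFinite _) ⟨u₀, hu₀⟩
  obtain ⟨y, hy, hy'⟩ := Set.exists_max_image {u | G.Adj v u} f (Set.toFinite _) ⟨u₀, hu₀⟩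
  exact ⟨_, x, y, hx, hy, fun u h => ⟨hx' u h, hy' u h⟩, rfl⟩

variable (G) in
/-- The mean of the least and of the greatest value of `f` on the successors of `v`. -/
noncomputable def avg (f : V → ℝ) (v : V) : ℝ := (G.exists_isMean f v).choose

theorem isMean_avg (f : V → ℝ) (v : V) : G.IsMean f v (G.avg f v) :=
  (G.exists_isMean f v).choose_spec

theorem IsMean.avg_eq {f : V → ℝ} {v : V} {r : ℝ} (h : G.IsMean f v r) : G.avg f v = r :=
  le_antisymm (by simpa using (isMean_avg f v).le_add (ε := 0) h (by simp))
    (by simpa using h.le_add (ε := 0) (isMean_avg f v) (by simp))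

theorem exists_reach_isBottom (v : V) : ∃ b, G.Reach v b ∧ G.IsBottom b := by
  obtain ⟨b, hb, hmin⟩ := Set.exists_min_image {u | G.Reach v u}
    (fun u => {x | G.Reach u x}.ncard) (Set.toFinite _) ⟨v, Relation.ReflTransGen.refl⟩
  refine ⟨b, hb, fun u hu => ?_⟩
  have hsub : {x | G.Reach u x} ⊆ {x | G.Reach b x} := fun x hx => hu.trans hx
  have heq := Set.eq_of_subset_of_ncard_le hsub (hmin u (hb.trans hu)) (Set.toFinite _)
  have : b ∈ {x | G.Reach u x} := heq ▸ Relation.ReflTransGen.refl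
  exact this

end Finite

section Potential

/-- A function whose growth along edges is controlled is bounded from above at each vertex that can
be reached from a given zero, by a bound that depends on the graph only. -/
theorem exists_bound_of_reach {R : Set V} (hR : ∀ v ∈ R, ∀ u, G.Adj v u → u ∈ R) (k : ℝ) {a b : V}
    (ha : a ∈ R) (hab : G.Reach a b) : ∃ C : ℝ, ∀ f : V → ℝ,
      (∀ v ∈ R, ∀ u, G.Adj v u → f u ≤ 4 * f v + k) → f a = 0 → f b ≤ C := by
  suffices b ∈ R ∧ ∃ C : ℝ, ∀ f : V → ℝ,
      (∀ v ∈ R, ∀ u, G.Adj v u → f u ≤ 4 * f v + k) → f a = 0 → f b ≤ C from this.2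
  induction hab with
  | refl => exact ⟨ha, 0, fun f _ h => h.le⟩
  | tail _ hbc ih =>
    obtain ⟨hb, C, hC⟩ := ih
    exact ⟨hR _ hb _ hbc, 4 * C + k, fun f hf h => by linarith [hf _ hb _ hbc, hC f hf h]⟩

variable [Fintype V]

theorem lipschitz_avg : LipschitzWith 1 G.avg := by
  refine LipschitzWith.of_dist_le_mul fun f f' => ?_
  rw [NNReal.coe_one, one_mul, dist_pi_le_iff dist_nonneg]
  intro v
  have key : ∀ f f' : V → ℝ, G.avg f v ≤ G.avg f' v + dist f f' := fun f f' =>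
    (isMean_avg f v).le_add (isMean_avg f' v) fun u _ => by
      have := dist_le_pi_dist f f' u
      rw [Real.dist_eq] at this
      linarith [le_abs_self (f u - f' u)]
  rw [Real.dist_eq, abs_le]
  have h1 := key f f'
  have h2 := key f' f
  rw [dist_comm f' f] at h2
  constructor <;> linarith

/-- The optimality equation of the discounted random-turn game, with discount factor `l`. -/
theorem exists_discounted (w : V → ℝ) {l : ℝ} (h0 : 0 ≤ l) (h1 : l < 1) :
    ∃ p : V → ℝ, ∀ v, p v = w v + l * G.avg p v := by
  have hc : ContractingWith ⟨l, h0⟩ (fun p : V → ℝ => fun v => w v + l * G.avg p v) := by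
    refine ⟨by exact_mod_cast h1, LipschitzWith.of_dist_le_mul fun f f' => ?_⟩
    rw [dist_pi_le_iff (by positivity)]
    intro v
    have h := (dist_le_pi_dist (G.avg f) (G.avg f') v).trans (lipschitz_avg.dist_le_mul f f')
    rw [NNReal.coe_one, one_mul] at h
    rw [dist_add_left, Real.dist_eq, ← mul_sub, abs_mul, abs_of_nonneg h0, ← Real.dist_eq]
    exact mul_le_mul_of_nonneg_left h h0
  exact ⟨hc.fixedPoint, fun v => congrFun hc.fixedPoint_isFixedPt.symm v⟩

open Filter Topology in
/-- The optimality equation of the undiscounted random-turn game on a bottom strongly connected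
component `R`: there are a value `c` and a potential `h`. They are limits of solutions of the
discounted equation, normalized to have the minimum `0` on `R`; these stay bounded since the value
at a successor is controlled by the value at the vertex. -/
theorem exists_potential (w : V → ℝ) {R : Set V} (hne : R.Nonempty)
    (hR : ∀ a ∈ R, ∀ b, G.Reach a b ↔ b ∈ R) :
    ∃ (h : V → ℝ) (c : ℝ), ∀ v ∈ R, G.IsMean h v (h v + c - w v) := by
  classical
  have hclosed : ∀ v ∈ R, ∀ u, G.Adj v u → u ∈ R := fun v hv u h =>
    (hR v hv u).1 (Relation.ReflTransGen.single h)
  obtain ⟨W, hW0, hW⟩ := exists_forall_abs_le w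
  let l : ℕ → ℝ := fun n => 1 - 1 / 2 / ((n : ℝ) + 1)
  have hl0 : ∀ n, 1 / 2 ≤ l n := fun n => by
    have : 1 / 2 / ((n : ℝ) + 1) ≤ 1 / 2 :=
      div_le_self (by norm_num) (by linarith [n.cast_nonneg (α := ℝ)])
    simp only [l]; linarith
  have hl1 : ∀ n, l n < 1 := fun n => by
    have : 0 < 1 / 2 / ((n : ℝ) + 1) := by positivity
    simp only [l]; linarith
  have hlim : Tendsto l atTop (𝓝 1) := by
    have : Tendsto (fun n : ℕ => 1 / 2 / ((n : ℝ) + 1)) atTop (𝓝 0) :=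
      tendsto_const_nhds.div_atTop (tendsto_natCast_atTop_atTop.atTop_add tendsto_const_nhds)
    simpa [l] using tendsto_const_nhds (x := (1 : ℝ)).sub this
  choose p hp using fun n => exists_discounted (G := G) w (by linarith [hl0 n]) (hl1 n)
  -- The coefficient `1 - l n` compensates the growth of the discounted values.
  have hpb : ∀ n v, |(1 - l n) * p n v| ≤ W := fun n v => by
    obtain ⟨x, hx⟩ := @Finite.exists_max V ℝ _ ⟨v⟩ _ fun v => |p n v|
    obtain ⟨a, b, -, -, -, hab⟩ := isMean_avg (G := G) (p n) x
    have hl := hl1 n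
    have hl' := hl0 n
    have h1 : |G.avg (p n) x| ≤ |p n x| := by
      rw [hab, abs_le]
      have ha := abs_le.1 (hx a)
      have hb := abs_le.1 (hx b)
      constructor <;> linarith
    have h2 : |p n x| ≤ W + l n * |p n x| := by
      calc |p n x| = |w x + l n * G.avg (p n) x| := by rw [← hp]
        _ ≤ |w x| + |l n * G.avg (p n) x| := abs_add_le _ _
        _ ≤ W + l n * |p n x| := by
          rw [abs_mul, abs_of_nonneg (by linarith : 0 ≤ l n)]
          exact add_le_add (hW x) (mul_le_mul_of_nonneg_left h1 (by linarith))
    rw [abs_mul, abs_of_pos (by linarith : 0 < 1 - l n)]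
    nlinarith [hx v]
  choose r hr hrmin using fun n => Set.exists_min_image R (p n) (Set.toFinite _) hne
  let h : ℕ → V → ℝ := fun n v => if v ∈ R then p n v - p n (r n) else 0
  let c : ℕ → ℝ := fun n => (1 - l n) * p n (r n)
  have heq : ∀ n, ∀ v ∈ R, h n v + c n = w v + l n * G.avg (h n) v := fun n v hv => by
    have h1 : G.avg (h n) v = G.avg (p n) v - p n (r n) := by
      apply IsMean.avg_eq
      obtain ⟨x, y, hx, hy, hu, he⟩ := isMean_avg (G := G) (p n) v
      refine IsMean.congr (f := fun u => p n u - p n (r n)) ⟨x, y, hx, hy, fun u h => ?_, ?_⟩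
        fun u hu => if_pos (hclosed v hv u hu)
      · exact ⟨by linarith [(hu u h).1], by linarith [(hu u h).2]⟩
      · rw [he]; ring
    rw [h1]
    simp only [h, if_pos hv, c]
    linarith [hp n v]
  have hnonneg : ∀ n v, 0 ≤ h n v := fun n v => by
    simp only [h]
    split_ifs with hv
    · linarith [hrmin n v hv]
    · exact le_rfl
  have hstep : ∀ n, ∀ v ∈ R, ∀ u, G.Adj v u → h n u ≤ 4 * h n v + 8 * W := fun n v hv u huv => by
    obtain ⟨x, y, hx, hy, hu, he⟩ := isMean_avg (G := G) (h n) v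
    have e := heq n v hv
    rw [he] at e
    have h1 := (hu u huv).2
    have h2 := hnonneg n x
    have h3 := hnonneg n y
    have h4 := (abs_le.1 (hpb n (r n))).2
    have h5 := (abs_le.1 (hW v)).1
    have h6 := hl0 n
    have h7 : 1 / 2 * ((h n x + h n y) / 2) ≤ l n * ((h n x + h n y) / 2) :=
      mul_le_mul_of_nonneg_right h6 (by linarith)
    simp only [c] at e
    linarith
  have hbound : ∃ C : ℝ, 0 ≤ C ∧ ∀ n v, h n v ≤ C := by
    have : ∀ ab : V × V, ∃ C : ℝ, ab.1 ∈ R → ab.2 ∈ R → ∀ f : V → ℝ,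
        (∀ v ∈ R, ∀ u, G.Adj v u → f u ≤ 4 * f v + 8 * W) → f ab.1 = 0 → f ab.2 ≤ C := by
      rintro ⟨a, b⟩
      by_cases hab : a ∈ R ∧ b ∈ R
      · obtain ⟨C, hC⟩ := exists_bound_of_reach hclosed (8 * W) hab.1 ((hR a hab.1 b).2 hab.2)
        exact ⟨C, fun _ _ => hC⟩
      · exact ⟨0, fun ha hb => absurd ⟨ha, hb⟩ hab⟩
    choose C hC using this
    obtain ⟨D, hD0, hD⟩ := exists_forall_abs_le C
    refine ⟨D, hD0, fun n v => ?_⟩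
    by_cases hv : v ∈ R
    · have := hC (r n, v) (hr n) hv (h n) (hstep n) (by simp [h])
      exact this.trans ((le_abs_self _).trans (hD _))
    · simpa [h, hv] using hD0
  obtain ⟨C, hC0, hC⟩ := hbound
  have hmem : ∀ n, (h n, c n) ∈ Metric.closedBall (0 : (V → ℝ) × ℝ) (max C W) := fun n => by
    rw [mem_closedBall_zero_iff, Prod.norm_def, max_le_iff]
    refine ⟨(pi_norm_le_iff_of_nonneg (le_max_of_le_left hC0)).2 fun v => ?_, ?_⟩
    · rw [Real.norm_eq_abs, abs_of_nonneg (hnonneg n v)]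
      exact (hC n v).trans (le_max_left _ _)
    · exact (hpb n (r n)).trans (le_max_right _ _)
  obtain ⟨⟨h', c'⟩, -, φ, hφ, htend⟩ :=
    tendsto_subseq_of_bounded Metric.isBounded_closedBall hmem
  rw [Prod.tendsto_iff] at htend
  obtain ⟨th, tc⟩ := htend
  refine ⟨h', c', fun v hv => ?_⟩
  have t1 : Tendsto (fun n => h (φ n) v + c (φ n)) atTop (𝓝 (h' v + c')) :=
    ((tendsto_pi_nhds.1 th) v).add tc
  have t2 : Tendsto (fun n => w v + l (φ n) * G.avg (h (φ n)) v) atTop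
      (𝓝 (w v + 1 * G.avg h' v)) :=
    tendsto_const_nhds.add ((hlim.comp hφ.tendsto_atTop).mul
      ((tendsto_pi_nhds.1 ((lipschitz_avg.continuous.tendsto h').comp th)) v))
  have t3 := tendsto_nhds_unique t1 (t2.congr fun n => (heq (φ n) v hv).symm)
  have : h' v + c' - w v = G.avg h' v := by rw [t3]; ring
  rw [this]
  exact isMean_avg _ _

end Potential

section Threshold

variable [Finite V]

/-- A function that solves the averaging equation off the set `Z` and has prescribed values in
`[0, 1]` on `Z`; it is obtained as the least supersolution. -/
theorem exists_harmonic (Z : Set V) (z : V → ℝ) (hz : ∀ v, z v ∈ Set.Icc (0 : ℝ) 1) :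
    ∃ t : V → ℝ, (∀ v, t v ∈ Set.Icc (0 : ℝ) 1) ∧ (∀ v ∈ Z, t v = z v) ∧
      ∀ v ∉ Z, G.IsMean t v (t v) := by
  classical
  let F : (V → ℝ) → V → ℝ := fun f v => if v ∈ Z then z v else G.avg f v
  have hmono : ∀ f f' : V → ℝ, (∀ v, f v ≤ f' v) → ∀ v, F f v ≤ F f' v := fun f f' hle v => by
    simp only [F]
    split_ifs
    · exact le_rfl
    · simpa using (isMean_avg f v).le_add (ε := 0) (isMean_avg f' v) fun u _ => by simpa using hle u
  have hF : ∀ f : V → ℝ, (∀ v, f v ∈ Set.Icc (0 : ℝ) 1) → ∀ v, F f v ∈ Set.Icc (0 : ℝ) 1 :=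
    fun f hf v => by
      simp only [F]
      split_ifs
      · exact hz v
      · obtain ⟨x, y, -, -, -, he⟩ := isMean_avg (G := G) f v
        rw [he]
        exact ⟨by linarith [(hf x).1, (hf y).1], by linarith [(hf x).2, (hf y).2]⟩
  let S : Set (V → ℝ) := {f | (∀ v, f v ∈ Set.Icc (0 : ℝ) 1) ∧ ∀ v, F f v ≤ f v}
  have h1 : (fun _ => 1) ∈ S :=
    ⟨fun _ => by simp, fun v => (hF (fun _ => 1) (fun _ => by simp) v).2⟩
  let t : V → ℝ := fun v => sInf ((fun f => f v) '' S)
  have hlow : ∀ f ∈ S, ∀ v, t v ≤ f v := fun f hf v =>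
    csInf_le ⟨0, by rintro _ ⟨f, hf, rfl⟩; exact (hf.1 v).1⟩ ⟨f, hf, rfl⟩
  have hgreat : ∀ v r, (∀ f ∈ S, r ≤ f v) → r ≤ t v := fun v r hr =>
    le_csInf ⟨1, _, h1, rfl⟩ (by rintro _ ⟨f, hf, rfl⟩; exact hr f hf)
  have ht : ∀ v, t v ∈ Set.Icc (0 : ℝ) 1 := fun v =>
    ⟨hgreat v 0 fun f hf => (hf.1 v).1, hlow _ h1 v⟩
  have hsup : ∀ v, F t v ≤ t v := fun v =>
    hgreat v _ fun f hf => (hmono _ _ (hlow f hf) v).trans (hf.2 v)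
  have hfix : ∀ v, t v = F t v := fun v =>
    le_antisymm (hlow (F t) ⟨hF t ht, hmono _ _ hsup⟩ v) (hsup v)
  refine ⟨t, ht, fun v hv => (hfix v).trans (if_pos hv), fun v hv => ?_⟩
  rw [(hfix v).trans (if_neg hv)]
  exact isMean_avg t v

/-- The threshold function `t` of the game together with a potential `h` on the bottom strongly
connected components: `t` solves the averaging equation and is `1` or `0` on such a component,
according to whether the value of the random-turn game on it is positive. -/
theorem exists_threshold_function (w : V → ℝ) : ∃ (t h : V → ℝ) (c : ℝ), 0 < c ∧
    (∀ v, t v ∈ Set.Icc (0 : ℝ) 1) ∧ (∀ v, G.IsMean t v (t v)) ∧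
    ∀ v, G.IsBottom v →
      (t v = 1 ∧ ∃ r, c ≤ r ∧ G.IsMean h v (h v + r - w v)) ∨
      (t v = 0 ∧ ∃ r, r ≤ 0 ∧ G.IsMean h v (h v + r - w v)) := by
  classical
  have := Fintype.ofFinite V
  let R : V → Set V := fun v => {u | G.Reach v u}
  have hRcongr : ∀ v, G.IsBottom v → ∀ u, G.Reach v u → R u = R v := fun v hv u hu =>
    Set.ext fun x => ⟨fun hx => hu.trans hx, fun hx => (hv u hu).trans hx⟩
  have : ∀ S : Set V, ∃ (h : V → ℝ) (c : ℝ), ∀ v, G.IsBottom v → R v = S →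
      G.IsMean h v (h v + c - w v) := fun S => by
    by_cases hS : ∃ v, G.IsBottom v ∧ R v = S
    · obtain ⟨v, hv, rfl⟩ := hS
      obtain ⟨h, c, hc⟩ := exists_potential (G := G) w (R := R v) ⟨v, Relation.ReflTransGen.refl⟩
        fun a ha b => by
          change b ∈ R a ↔ _
          rw [hRcongr v hv a ha]
      refine ⟨h, c, fun u _ hu => hc u ?_⟩
      rw [← hu]
      exact Relation.ReflTransGen.refl
    · exact ⟨0, 0, fun v hv hvS => absurd ⟨v, hv, hvS⟩ hS⟩
  choose h c hc using this
  obtain ⟨ε, hε, hεc⟩ := exists_pos_forall_le fun v => c (R v)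
  obtain ⟨t, ht, htZ, htm⟩ := exists_harmonic (G := G) {v | G.IsBottom v}
    (fun v => if 0 < c (R v) then 1 else 0) fun v => by split_ifs <;> simp
  have hadj : ∀ v, G.IsBottom v → ∀ u, G.Adj v u → G.IsBottom u ∧ R u = R v := fun v hv u huv =>
    have hr : G.Reach v u := Relation.ReflTransGen.single huv
    ⟨Reach.mono_bottom hv hr, hRcongr v hv u hr⟩
  refine ⟨t, fun v => h (R v) v, ε, hε, ht, fun v => ?_, fun v hv => ?_⟩
  · by_cases hv : G.IsBottom v
    · obtain ⟨u, hu⟩ := G.exists_adj v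
      have he : ∀ u, G.Adj v u → t u = t v := fun u huv => by
        rw [htZ u (hadj v hv u huv).1, htZ v hv, (hadj v hv u huv).2]
      refine ⟨u, u, hu, hu, fun x hx => ?_, ?_⟩
      · simp [he u hu, he x hx]
      · rw [he u hu]; ring
    · exact htm v hv
  · have hm : G.IsMean (fun v => h (R v) v) v (h (R v) v + c (R v) - w v) :=
      (hc (R v) v hv rfl).congr fun u huv => by rw [(hadj v hv u huv).2]
    by_cases hpos : 0 < c (R v)
    · exact Or.inl ⟨(htZ v hv).trans (if_pos hpos), c (R v), hεc v hpos, hm⟩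
    · exact Or.inr ⟨(htZ v hv).trans (if_neg hpos), c (R v), not_lt.1 hpos, hm⟩

end Threshold

end Game

end Bidding

/-! ### Guides: a potential on the whole graph -/

namespace Bidding

namespace Game

variable {V : Type*} {G : Game V}

/-- The data from which a player builds his bids, when `g v` is what he gains by a visit to `v`.
The value `θ v` is his threshold budget at `v`, and `m v` and `hi v` are successors at which it is
least and greatest; the player moves to `m v` upon winning. As long as the opponent also moves to
successors where `θ` is greatest, `Q` is a potential for the random-turn game with gain `g` and
drift `c`. -/
structure Guide (G : Game V) (g θ Q : V → ℝ) (c : ℝ) (m hi : V → V) : Prop where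
  theta_mem : ∀ v, θ v ∈ Set.Icc (0 : ℝ) 1
  adj : ∀ v, G.Adj v (m v)
  theta_le : ∀ v u, G.Adj v u → θ u ≤ θ (hi v)
  theta_move_le : ∀ v u, G.Adj v u → θ (m v) ≤ θ u
  theta_eq : ∀ v, θ v = (θ (m v) + θ (hi v)) / 2
  move : ∀ v, θ v < 1 → Q v + c ≤ g v + Q (m v)
  drift : ∀ v, θ v < 1 → ∀ u, G.Adj v u → θ u = θ (hi v) → Q v + c ≤ g v + (Q (m v) + Q u) / 2

/-- A distance to `Z` along the relation `A`, on the points from which `Z` can be reached. -/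
theorem exists_distance {α : Type*} (A : α → α → Prop) (Z : Set α) : ∃ d : α → ℕ, ∀ v ∉ Z,
    (∃ z ∈ Z, Relation.ReflTransGen A v z) → ∃ u, A v u ∧ d u < d v := by
  let W : ℕ → Set α := fun n => Nat.rec Z (fun _ S => {v | ∃ u, A v u ∧ u ∈ S}) n
  refine ⟨fun v => sInf {n | v ∈ W n}, fun v hv hreach => ?_⟩
  obtain ⟨z, hz, hvz⟩ := hreach
  have hne : {n | v ∈ W n}.Nonempty := by
    clear hv
    induction hvz using Relation.ReflTransGen.head_induction_on with
    | refl => exact ⟨0, hz⟩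
    | head hab _ ih =>
      obtain ⟨n, hn⟩ := ih
      exact ⟨n + 1, _, hab, hn⟩
  have hmem : v ∈ W (sInf {n | v ∈ W n}) := Nat.sInf_mem hne
  rcases hn : sInf {n | v ∈ W n} with _ | n
  · rw [hn] at hmem
    exact absurd hmem hv
  · rw [hn] at hmem
    obtain ⟨u, hvu, hu⟩ := hmem
    refine ⟨u, hvu, ?_⟩
    have : sInf {n | u ∈ W n} ≤ n := Nat.sInf_le hu
    dsimp only
    omega

variable [Finite V]

/-- By moves to successors with the least threshold, a bottom component with threshold `0` can be
reached from every vertex with a threshold below `1`. A vertex of least threshold among those for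
which this fails would have only successors of the same kind, and so would everything reachable
from it, including a bottom component. -/
theorem exists_reach_target {θ : V → ℝ} (hmean : ∀ v, G.IsMean θ v (θ v))
    (hbot : ∀ v, G.IsBottom v → θ v = 1 ∨ θ v = 0) (v : V) (hv : θ v < 1) :
    ∃ z ∈ {z | G.IsBottom z ∧ θ z = 0},
      Relation.ReflTransGen (fun v u => G.Adj v u ∧ ∀ x, G.Adj v x → θ u ≤ θ x) v z := by
  by_contra hcon
  let C : Set V := {v | θ v < 1 ∧ ¬ ∃ z ∈ {z | G.IsBottom z ∧ θ z = 0},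
    Relation.ReflTransGen (fun v u => G.Adj v u ∧ ∀ x, G.Adj v x → θ u ≤ θ x) v z}
  obtain ⟨a, haC, hmin⟩ := Set.exists_min_image C θ (Set.toFinite _) ⟨v, hv, hcon⟩
  have hstep : ∀ b ∈ C, θ b = θ a → ∀ u, G.Adj b u → u ∈ C ∧ θ u = θ a := fun b hb hba u hbu => by
    obtain ⟨x, y, hx, hy, hxy, he⟩ := hmean b
    have hC : ∀ x, G.Adj b x → (∀ u, G.Adj b u → θ x ≤ θ u) → θ x ≤ θ b → x ∈ C :=
      fun x hx hxm hle => ⟨hle.trans_lt hb.1, fun ⟨z, hz, hxz⟩ =>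
        hb.2 ⟨z, hz, Relation.ReflTransGen.head ⟨hx, hxm⟩ hxz⟩⟩
    have h1 := hmin x (hC x hx (fun u hu => (hxy u hu).1) (by linarith [(hxy y hy).1]))
    have hall : ∀ u, G.Adj b u → θ u = θ a := fun u hu =>
      le_antisymm (by linarith [(hxy u hu).2, (hxy x hx).2]) (h1.trans (hxy u hu).1)
    refine ⟨hC u hbu (fun x hx => ?_) ?_, hall u hbu⟩
    · rw [hall u hbu, hall x hx]
    · rw [hall u hbu, hba]
  obtain ⟨b, hab, hb⟩ := exists_reach_isBottom (G := G) a
  have hreach : b ∈ C ∧ θ b = θ a := by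
    clear hb
    induction hab with
    | refl => exact ⟨haC, rfl⟩
    | tail _ hbc ih => exact hstep _ ih.1 ih.2 _ hbc
  rcases hbot b hb with h | h
  · exact hreach.1.1.ne h
  · exact hreach.1.2 ⟨b, ⟨hb, h⟩, Relation.ReflTransGen.refl⟩

/-- The potential of a guide agrees up to a constant with the given potential `h` on the target,
the bottom components with threshold `0`. Elsewhere it grows by a factor of `3` with every move
towards the target, which outweighs the gains and the chance of being driven away. -/
theorem exists_guide {g θ h : V → ℝ} {c : ℝ} (hc : 0 ≤ c) (hmem : ∀ v, θ v ∈ Set.Icc (0 : ℝ) 1)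
    (hmean : ∀ v, G.IsMean θ v (θ v))
    (hbot : ∀ v, G.IsBottom v → θ v = 1 ∨
      (θ v = 0 ∧ ∃ r, c ≤ r ∧ G.IsMean h v (h v + r - g v))) :
    ∃ (Q : V → ℝ) (m hi : V → V), G.Guide g θ Q c m hi := by
  classical
  let Z : Set V := {z | G.IsBottom z ∧ θ z = 0}
  obtain ⟨d, hd⟩ := exists_distance (fun v u => G.Adj v u ∧ ∀ x, G.Adj v x → θ u ≤ θ x) Z
  obtain ⟨N, hN⟩ := (Set.finite_range d).bddAbove
  have hdN : ∀ v, d v ≤ N := fun v => hN ⟨v, rfl⟩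
  obtain ⟨H, hH0, hH⟩ := exists_forall_abs_le h
  obtain ⟨W, hW0, hW⟩ := exists_forall_abs_le g
  let M : ℝ := 2 * (c + W)
  have hM0 : 0 ≤ M := by positivity
  let Q : V → ℝ := fun v => if v ∈ Z then h v + H + M * 3 ^ N else M * 3 ^ (N - d v)
  have hQlow : ∀ v, M * 3 ^ (N - d v) ≤ Q v := fun v => by
    have h1 : (3 : ℝ) ^ (N - d v) ≤ 3 ^ N := pow_le_pow_right₀ (by norm_num) (Nat.sub_le _ _)
    have h2 := mul_le_mul_of_nonneg_left h1 hM0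
    have h3 := abs_le.1 (hH v)
    simp only [Q]
    split_ifs
    · linarith
    · exact le_rfl
  have hQ0 : ∀ v, 0 ≤ Q v := fun v => le_trans (by positivity) (hQlow v)
  have hZadj : ∀ v ∈ Z, ∀ u, G.Adj v u → u ∈ Z := fun v hv u hu => by
    refine ⟨Reach.mono_bottom hv.1 (Relation.ReflTransGen.single hu), ?_⟩
    obtain ⟨x, y, hx, hy, hxy, he⟩ := hmean v
    rw [hv.2] at he
    linarith [(hxy u hu).1, (hxy u hu).2, (hmem x).1, (hmem y).1, (hmem u).1]
  have key : ∀ v, ∃ m hi, G.Adj v m ∧ (∀ u, G.Adj v u → θ u ≤ θ hi) ∧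
      (∀ u, G.Adj v u → θ m ≤ θ u) ∧ θ v = (θ m + θ hi) / 2 ∧
      (θ v < 1 → Q v + c ≤ g v + Q m) ∧
      (θ v < 1 → ∀ u, G.Adj v u → θ u = θ hi → Q v + c ≤ g v + (Q m + Q u) / 2) := fun v => by
    obtain ⟨x, y, hx, hy, hxy, he⟩ := hmean v
    by_cases hv : v ∈ Z
    · have hθ : ∀ u, G.Adj v u → θ u = 0 := fun u hu => (hZadj v hv u hu).2
      obtain ⟨r, hr, a, b, ha, hb, hab, hm⟩ := (hbot v hv.1).resolve_left (by rw [hv.2]; simp) |>.2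
      have hQv : Q v = h v + H + M * 3 ^ N := if_pos hv
      have hQ : ∀ u, G.Adj v u → Q u = h u + H + M * 3 ^ N := fun u hu => if_pos (hZadj v hv u hu)
      have hdrift : ∀ u, G.Adj v u → Q v + c ≤ g v + (Q b + Q u) / 2 := fun u hu => by
        rw [hQ u hu, hQ b hb, hQv]
        linarith [(hab u hu).1]
      refine ⟨b, b, hb, fun u hu => ?_, fun u hu => ?_, ?_, fun _ => ?_, fun _ u hu _ => hdrift u hu⟩
      · rw [hθ u hu, hθ b hb]
      · rw [hθ u hu, hθ b hb]
      · rw [hθ b hb, hv.2]; simp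
      · linarith [hdrift b hb]
    · by_cases hlt : θ v < 1
      · obtain ⟨u, ⟨hu, hmin⟩, hdu⟩ := hd v hv (exists_reach_target hmean
          (fun v hv => (hbot v hv).imp_right And.left) v hlt)
        have hux : θ u = θ x := le_antisymm (hmin x hx) (hxy u hu).1
        have hQv : Q v = M * 3 ^ (N - d v) := if_neg hv
        have hpow : (1 : ℝ) ≤ 3 ^ (N - d v) := one_le_pow₀ (by norm_num)
        have hQu : M * (3 * 3 ^ (N - d v)) ≤ Q u := by
          refine le_trans (mul_le_mul_of_nonneg_left ?_ hM0) (hQlow u)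
          rw [← pow_succ']
          exact pow_le_pow_right₀ (by norm_num) (by have := hdN v; omega)
        have h1 : M ≤ Q v := by rw [hQv]; nlinarith
        have h2 : 3 * Q v ≤ Q u := by rw [hQv]; linarith
        have h3 := (abs_le.1 (hW v)).1
        have h4 : M = 2 * (c + W) := rfl
        refine ⟨u, y, hu, fun u hu => (hxy u hu).2, hmin, by rw [hux, he], fun _ => ?_,
          fun _ z _ _ => ?_⟩
        · linarith
        · linarith [hQ0 z]
      · exact ⟨x, y, hx, fun u hu => (hxy u hu).2, fun u hu => (hxy u hu).1, he,
          fun h => absurd h hlt, fun h => absurd h hlt⟩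
  choose m hi h1 h2 h3 h4 h5 h6 using key
  exact ⟨Q, m, hi, hmem, h1, h2, h3, h4, h5, h6⟩

end Game

end Bidding

/-! ### Plays and the strategies of both players -/

namespace Bidding

section Play

variable {V : Type*} {G : Game V} {τ : TieBreak V} {P Q : Player} {b : ℝ} {v : V}
  {f g : Strategy V}

theorem budget_start (P : Player) (b : ℝ) (v : V) : budget P b P (History.start v) = b := by
  simp [budget, initialBudget, History.payment]

theorem budget_round (P : Player) (b : ℝ) (h : History V) (v : V) (c : ℝ) (i : Player) :
    budget P b P (h.round v c i) = budget P b P h - if i = P then c else -c := by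
  simp only [budget, History.payment]
  ring

theorem payment_add_payment (hQ : Q ≠ P) (h : History V) : h.payment P + h.payment Q = 0 := by
  induction h with
  | start v => simp [History.payment]
  | round h v c i ih =>
    have : (if i = P then c else -c) + (if i = Q then c else -c) = 0 := by
      cases i <;> cases P <;> cases Q <;> simp_all
    simp only [History.payment]
    linarith

theorem budget_add_budget (hQ : Q ≠ P) (b : ℝ) (h : History V) :
    budget P b P h + budget P b Q h = 1 := by
  have := payment_add_payment hQ h
  simp only [budget, initialBudget, if_neg hQ, if_pos]
  linarith

theorem outcome_succ_cases (τ : TieBreak V) (v : V) (P : Player) (f g : Strategy V) (n : ℕ) :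
    let h := outcome τ v (profile P f g) n
    outcome τ v (profile P f g) (n + 1) = h.round (f h).move (f h).bid P ∨
      ∃ Q, Q ≠ P ∧ (f h).bid ≤ (g h).bid ∧
        outcome τ v (profile P f g) (n + 1) = h.round (g h).move (g h).bid Q := by
  intro h
  have hstep : outcome τ v (profile P f g) (n + 1) =
    step τ h (profile P f g Player.min h) (profile P f g Player.max h) := rfl
  rw [hstep]
  cases P
  · simp only [profile, if_pos, reduceCtorEq, if_false, step]
    split_ifs with h1 h2
    · exact Or.inl rfl
    · exact Or.inr ⟨_, by simp, h2.le, rfl⟩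
    · split
      · exact Or.inl rfl
      · exact Or.inr ⟨_, by simp, not_lt.1 h1, rfl⟩
  · simp only [profile, if_pos, reduceCtorEq, if_false, step]
    split_ifs with h1 h2
    · exact Or.inr ⟨_, by simp, h1.le, rfl⟩
    · exact Or.inl rfl
    · split
      · exact Or.inr ⟨_, by simp, not_lt.1 h2, rfl⟩
      · exact Or.inl rfl

theorem exists_player_ne (P : Player) : ∃ Q, Q ≠ P := by
  cases P
  · exact ⟨Player.max, by simp⟩
  · exact ⟨Player.min, by simp⟩

/-- A strategy whose bids are clamped to the interval from `0` to the current budget never runs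
out of budget. -/
theorem legal_of_clamped (hb : 0 ≤ b) {β : History V → ℝ}
    (hbid : ∀ h, (f h).bid = min (max 0 (β h)) (budget P b P h))
    (hmove : ∀ h, G.Adj h.last (f h).move) : G.Legal τ P b f := by
  intro v g n hg
  have hnonneg : ∀ k ≤ n, 0 ≤ budget P b P (outcome τ v (profile P f g) k) := fun k => by
    induction k with
    | zero => exact fun _ => by rwa [outcome, budget_start]
    | succ k ih =>
      intro hk
      have h0 := ih (by omega)
      rcases outcome_succ_cases τ v P f g k with h | ⟨Q, hQ, -, h⟩
      · rw [h, budget_round, if_pos rfl, hbid]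
        linarith [min_le_right (max 0 (β (outcome τ v (profile P f g) k)))
          (budget P b P (outcome τ v (profile P f g) k))]
      · rw [h, budget_round, if_neg hQ]
        linarith [(hg Q hQ k (by omega)).1]
  refine ⟨?_, ?_, hmove _⟩
  · rw [hbid]
    exact le_min (le_max_left _ _) (hnonneg n le_rfl)
  · rw [hbid]
    exact min_le_right _ _

theorem budget_le_one (hg : ∀ Q, Q ≠ P → ∀ n, G.Permitted P b Q (outcome τ v (profile P f g) n)
      (g (outcome τ v (profile P f g) n))) (n : ℕ) :
    budget P b P (outcome τ v (profile P f g) n) ≤ 1 := by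
  obtain ⟨Q, hQ⟩ := exists_player_ne P
  have h := hg Q hQ n
  linarith [h.1, h.2.1, budget_add_budget hQ b (outcome τ v (profile P f g) n)]

theorem energy_outcome_succ (τ : TieBreak V) (v : V) (σ : Player → Strategy V) (n : ℕ) :
    (outcome τ v σ (n + 1)).energy G =
      (outcome τ v σ n).energy G + G.weight (outcome τ v σ n).last := by
  rw [outcome, step]
  split_ifs
  · rfl
  · rfl
  · split <;> rfl

theorem abs_energy_div_le {W : ℝ} (hW0 : 0 ≤ W) (hW : ∀ v, |(G.weight v : ℝ)| ≤ W) (τ : TieBreak V)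
    (v : V) (σ : Player → Strategy V) (n : ℕ) :
    |((outcome τ v σ n).energy G : ℝ) / n| ≤ W := by
  have : |((outcome τ v σ n).energy G : ℝ)| ≤ W * n := by
    induction n with
    | zero => simp [outcome, History.energy]
    | succ n ih =>
      rw [energy_outcome_succ]
      push_cast
      linarith [abs_add_le ((outcome τ v σ n).energy G : ℝ) (G.weight (outcome τ v σ n).last),
        hW (outcome τ v σ n).last]
  rw [abs_div, Nat.abs_cast]
  exact div_le_of_le_mul₀ n.cast_nonneg hW0 this

open Filter in
theorem le_meanPayoff [Finite V] {σ : Player → Strategy V} {c D : ℝ} (hc : 0 < c)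
    (h : ∀ n : ℕ, D + 2 * c * n ≤ ((outcome τ v σ n).energy G : ℝ)) :
    c ≤ G.meanPayoff (outcome τ v σ) := by
  obtain ⟨W, hW0, hW⟩ := exists_forall_abs_le fun v => (G.weight v : ℝ)
  refine le_liminf_of_le (isCoboundedUnder_ge_of_le atTop (x := W) fun n =>
    (abs_le.1 (abs_energy_div_le hW0 hW τ v σ n)).2) ?_
  obtain ⟨N, hN⟩ := exists_nat_ge (-D / c)
  filter_upwards [eventually_ge_atTop N, eventually_gt_atTop 0] with n hn hn0
  have hn0' : (0 : ℝ) < n := by exact_mod_cast hn0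
  have hn' : (N : ℝ) ≤ n := by exact_mod_cast hn
  have h1 := (div_le_iff₀ hc).1 (hN.trans hn')
  rw [le_div_iff₀ hn0']
  linarith [h n]

open Filter in
theorem meanPayoff_nonpos [Finite V] {σ : Player → Strategy V} {C : ℝ}
    (h : ∃ᶠ n in atTop, ((outcome τ v σ n).energy G : ℝ) ≤ C) :
    G.meanPayoff (outcome τ v σ) ≤ 0 := by
  obtain ⟨W, hW0, hW⟩ := exists_forall_abs_le fun v => (G.weight v : ℝ)
  refine le_of_forall_pos_le_add fun ε hε => ?_
  refine liminf_le_of_frequently_le ?_ (isBoundedUnder_of ⟨-W, fun n =>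
    (abs_le.1 (abs_energy_div_le hW0 hW τ v σ n)).1⟩)
  obtain ⟨N, hN⟩ := exists_nat_ge (C / ε)
  refine (h.and_eventually (eventually_ge_atTop (N + 1))).mono fun n hn => ?_
  have hn0' : (0 : ℝ) < n := by exact_mod_cast (by omega : 0 < n)
  have hn' : (N : ℝ) ≤ n := by exact_mod_cast (by omega : N ≤ n)
  have h1 := (div_le_iff₀ hε).1 (hN.trans hn')
  rw [zero_add, div_le_iff₀ hn0']
  linarith [hn.1]

end Play

/-- What a unit of energy is worth to a player. -/
def Player.sign : Player → ℝ
  | min => -1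
  | max => 1

namespace Game

variable {V : Type*} {G : Game V} {g θ Q : V → ℝ} {c : ℝ} {m hi : V → V}

/-- The amount by which a move to `m v` beats the drift `c` of the potential `Q`. -/
def surplus (g Q : V → ℝ) (c : ℝ) (m : V → V) (v : V) : ℝ := g v + Q (m v) - Q v - c

/-- The bid at `v` with budget `x`: the bid `θ v - θ (m v)` that preserves the excess `x - θ v` of
the budget over the threshold, plus a part of this excess that is proportional to the stakes in
the random-turn game, clamped to the interval from `0` to `x`. -/
noncomputable def guidedBid (θ s : V → ℝ) (m : V → V) (a : ℝ) (v : V) (x : ℝ) : ℝ :=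
  min (max 0 (θ v - θ (m v) + a * s v * (x - θ v))) x

/-- The strategy that bids according to `guidedBid`, with a proportion that may depend on the
history, and moves to `m v`. -/
noncomputable def guided (P : Player) (b : ℝ) (θ s : V → ℝ) (m : V → V) (a : History V → ℝ) :
    Strategy V := fun h =>
  { bid := guidedBid θ s m (a h) h.last (budget P b P h)
    move := m h.last }

/-- The excess of the budget over the threshold. -/
noncomputable def excess (P : Player) (b : ℝ) (θ : V → ℝ) (h : History V) : ℝ :=
  budget P b P h - θ h.last

/-- The energy from the point of view of `P`, corrected by the potential of the current vertex. -/
noncomputable def level (G : Game V) (P : Player) (Q : V → ℝ) (h : History V) : ℝ :=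
  P.sign * h.energy G + Q h.last

theorem legal_guided {τ : TieBreak V} {P : Player} {b : ℝ} (hb : 0 ≤ b) (hm : ∀ v, G.Adj v (m v))
    (s : V → ℝ) (a : History V → ℝ) : G.Legal τ P b (guided P b θ s m a) :=
  legal_of_clamped hb (β := fun h => θ h.last - θ (m h.last) +
    a h * s h.last * (budget P b P h - θ h.last)) (fun _ => rfl) fun _ => hm _

theorem level_round (P : Player) (Q : V → ℝ) (h : History V) (v : V) (b : ℝ) (i : Player) :
    G.level P Q (h.round v b i) =
      G.level P Q h + (P.sign * G.weight h.last + Q v - Q h.last) := by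
  simp only [level, History.energy, History.last]
  push_cast
  ring

/-- The trade-off between excess and level in a round. Upon winning, a share of the excess buys
the surplus; upon losing, the same share is gained for the loss of at most the surplus, unless the
opponent makes a move that increases the excess by a fixed amount. -/
theorem Guide.round_cases {P : Player} {b : ℝ} {τ : TieBreak V} {v : V} {f : Strategy V}
    {a : History V → ℝ} {ε L : ℝ} {s : V → ℝ} {π : ℕ → History V}
    (hG : G.Guide (fun v => P.sign * G.weight v) θ Q c m hi)
    (hs : s = surplus (fun v => P.sign * G.weight v) Q c m)
    (hε : ∀ u y, θ u < θ y → θ u + ε ≤ θ y)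
    (hL : ∀ v u, -L ≤ P.sign * G.weight v + Q u - Q v)
    (ha : ∀ h, 0 ≤ a h) (has : ∀ h, a h * s h.last < 1)
    (hπ : π = outcome τ v (profile P (guided P b θ s m a) f))
    (hf : ∀ R, R ≠ P → ∀ n, G.Permitted P b R (π n) (f (π n))) (n : ℕ)
    (hpos : 0 < excess P b θ (π n)) :
    excess P b θ (π n) ≤ 1 ∧ 0 ≤ s (π n).last ∧
      ((excess P b θ (π (n + 1)) = excess P b θ (π n) * (1 - a (π n) * s (π n).last) ∧
          G.level P Q (π (n + 1)) = G.level P Q (π n) + c + s (π n).last) ∨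
        (excess P b θ (π n) * (1 + a (π n) * s (π n).last) ≤ excess P b θ (π (n + 1)) ∧
          G.level P Q (π n) + c - s (π n).last ≤ G.level P Q (π (n + 1))) ∨
        (excess P b θ (π n) + ε ≤ excess P b θ (π (n + 1)) ∧
          G.level P Q (π n) - L ≤ G.level P Q (π (n + 1)))) := by
  subst hπ
  set h := outcome τ v (profile P (guided P b θ s m a) f) n
  set h' := outcome τ v (profile P (guided P b θ s m a) f) (n + 1)
  set z := a h * s h.last
  have hx1 : budget P b P h ≤ 1 := budget_le_one hf n
  have hδ : excess P b θ h = budget P b P h - θ h.last := rfl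
  have hθ0 := (hG.theta_mem h.last).1
  have hlt : θ h.last < 1 := by linarith
  have hsh : s h.last = P.sign * G.weight h.last + Q (m h.last) - Q h.last - c := by
    rw [hs, surplus]
  have hs0 : 0 ≤ s h.last := by linarith [hG.move h.last hlt]
  have hz0 : 0 ≤ z := mul_nonneg (ha h) hs0
  have hz1 : z < 1 := has h
  have hbid : (guided P b θ s m a h).bid = θ h.last - θ (m h.last) + z * excess P b θ h := by
    have h1 : 0 ≤ θ h.last - θ (m h.last) + z * excess P b θ h := by
      have := mul_nonneg hz0 hpos.le
      have := hG.theta_move_le h.last _ (hG.adj h.last)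
      linarith [hG.theta_eq h.last, hG.theta_le h.last _ (hG.adj h.last)]
    have h2 : θ h.last - θ (m h.last) + z * excess P b θ h ≤ budget P b P h := by
      have := (hG.theta_mem (m h.last)).1
      have : z * excess P b θ h ≤ excess P b θ h := mul_le_of_le_one_left hpos.le hz1.le
      linarith
    exact (congrArg (min · _) (max_eq_right h1)).trans (min_eq_left h2)
  refine ⟨by linarith, hs0, ?_⟩
  rcases outcome_succ_cases τ v P (guided P b θ s m a) f n with he | ⟨R, hR, hle, he⟩
  · left
    have he : h' = h.round (m h.last) (guided P b θ s m a h).bid P := he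
    constructor
    · rw [he, excess, budget_round, if_pos rfl, hbid, History.last, hδ]
      ring
    · rw [he, level_round, hsh]
      ring
  · right
    have he : h' = h.round (f h).move (f h).bid R := he
    have hle : (guided P b θ s m a h).bid ≤ (f h).bid := hle
    have hadj : G.Adj h.last (f h).move := (hf R hR n).2.2
    have hδ' : excess P b θ h' = budget P b P h + (f h).bid - θ (f h).move := by
      rw [he, excess, budget_round, if_neg hR, History.last]
      ring
    have hX' : G.level P Q h' =
        G.level P Q h + (P.sign * G.weight h.last + Q (f h).move - Q h.last) := by
      rw [he, level_round]
    have hmean := hG.theta_eq h.last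
    rcases (hG.theta_le h.last _ hadj).eq_or_lt with heq | hlt'
    · left
      constructor
      · rw [hδ', heq]
        linarith
      · have := hG.drift h.last hlt _ hadj heq
        rw [hX']
        linarith
    · right
      constructor
      · have := mul_nonneg hz0 hpos.le
        linarith [hε _ _ hlt']
      · linarith [hL h.last (f h).move]

variable [Finite V]

theorem exists_gap (θ : V → ℝ) : ∃ ε : ℝ, 0 < ε ∧ ∀ u y, θ u < θ y → θ u + ε ≤ θ y := by
  obtain ⟨ε, hε, h⟩ := exists_pos_forall_le fun p : V × V => θ p.2 - θ p.1
  exact ⟨ε, hε, fun u y huy => by linarith [h (u, y) (sub_pos.2 huy)]⟩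

theorem exists_loss_bound (g Q : V → ℝ) : ∃ L : ℝ, 0 ≤ L ∧ ∀ v u, -L ≤ g v + Q u - Q v := by
  obtain ⟨L, hL0, hL⟩ := exists_forall_abs_le fun p : V × V => g p.1 + Q p.2 - Q p.1
  exact ⟨L, hL0, fun v u => (abs_le.1 (hL (v, u))).1⟩

/-- With a positive drift, a small constant proportion `a` makes `excess * exp (a * level)` grow
exponentially; as the excess is at most `1`, the energy grows linearly. -/
theorem Guide.exists_guarantees_max (hc : 0 < c)
    (hG : G.Guide (fun v => Player.max.sign * G.weight v) θ Q c m hi) :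
    ∃ a : ℝ, ∀ (τ : TieBreak V) (v : V) (b : ℝ), θ v < b →
      G.Guarantees τ Player.max b v (guided Player.max b θ
        (surplus (fun v => Player.max.sign * G.weight v) Q c m) m fun _ => a) (Set.Ici (c / 4)) := by
  set s := surplus (fun v => Player.max.sign * G.weight v) Q c m with hs
  obtain ⟨ε, hε, hgap⟩ := exists_gap θ
  obtain ⟨L, hL0, hL⟩ := exists_loss_bound (fun v => Player.max.sign * G.weight v) Q
  obtain ⟨S, hS0, hS⟩ := exists_forall_abs_le s
  obtain ⟨D, hD0, hD⟩ := exists_forall_abs_le Q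
  -- The bounds on `a` keep the share of the excess that is bid below `1 / 2`, let the drift pay for
  -- second-order errors, and let a gain of `ε` in excess make up for a loss of `L` in level.
  obtain ⟨a, ha, ha1, ha2, ha3⟩ : ∃ a : ℝ, 0 < a ∧ a * (2 * (S + 1)) ≤ 1 ∧
      a * (4 * (S + 1) ^ 2) ≤ c ∧ a * (L + c / 2) ≤ Real.log (1 + ε) := by
    have hlog : 0 < Real.log (1 + ε) := Real.log_pos (by linarith)
    refine ⟨min (min (1 / (2 * (S + 1))) (c / (4 * (S + 1) ^ 2))) (Real.log (1 + ε) / (L + c / 2)),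
      by positivity, ?_, ?_, ?_⟩
    · rw [← le_div_iff₀ (by positivity)]
      exact (min_le_left _ _).trans (min_le_left _ _)
    · rw [← le_div_iff₀ (by positivity)]
      exact (min_le_left _ _).trans (min_le_right _ _)
    · rw [← le_div_iff₀ (by positivity)]
      exact min_le_right _ _
  have has : ∀ v, a * s v ≤ 1 / 2 := fun v => by
    have := mul_le_mul_of_nonneg_left ((le_abs_self _).trans (hS v)) ha.le
    linarith
  have hsq : ∀ v, 0 ≤ s v → (a * s v) ^ 2 ≤ a * c / 4 := fun v hv => by
    have h1 : s v ^ 2 ≤ (S + 1) ^ 2 :=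
      pow_le_pow_left₀ hv (by linarith [(le_abs_self _).trans (hS v)]) 2
    have h2 : a * (4 * s v ^ 2) ≤ c := by
      refine le_trans (mul_le_mul_of_nonneg_left ?_ ha.le) ha2
      linarith
    nlinarith
  refine ⟨a, fun τ v b hb =>
    ⟨legal_guided ((hG.theta_mem v).1.trans hb.le) hG.adj s _, fun f hf => ?_⟩⟩
  set π := outcome τ v (profile Player.max (guided Player.max b θ s m fun _ => a) f) with hπ
  have hround := hG.round_cases hs hgap hL (a := fun _ => a) (fun _ => ha.le)
    (fun h => by linarith [has h.last]) hπ hf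
  have h0 : 0 < excess Player.max b θ (π 0) := by
    have : excess Player.max b θ (π 0) = b - θ v := by
      simp [π, outcome, excess, budget_start, History.last]
    linarith
  have hinv : ∀ n : ℕ, 0 < excess Player.max b θ (π n) ∧
      excess Player.max b θ (π 0) * Real.exp (a * G.level Player.max Q (π 0)) *
        Real.exp (a * c / 2 * n) ≤
      excess Player.max b θ (π n) * Real.exp (a * G.level Player.max Q (π n)) := fun n => by
    induction n with
    | zero => simpa using h0
    | succ n ih =>
      obtain ⟨hpos, ih⟩ := ih
      obtain ⟨hδ1, hs0, hcases⟩ := hround n hpos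
      have hz0 : 0 ≤ a * s (π n).last := mul_nonneg ha.le hs0
      have hz1 := has (π n).last
      have hz2 := hsq _ hs0
      have hac : 0 < a * c := mul_pos ha hc
      suffices 0 < excess Player.max b θ (π (n + 1)) ∧
          excess Player.max b θ (π n) * Real.exp (a * G.level Player.max Q (π n)) *
            Real.exp (a * c / 2) ≤
          excess Player.max b θ (π (n + 1)) * Real.exp (a * G.level Player.max Q (π (n + 1))) by
        refine ⟨this.1, le_trans ?_ this.2⟩
        push_cast
        rw [mul_add, mul_one, Real.exp_add, ← mul_assoc]
        exact mul_le_mul_of_nonneg_right ih (Real.exp_pos _).le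
      -- A factor `k` on the excess and a gain `l` of level suffice if `exp (a * c / 2)` is at
      -- most `k * exp (a * l)`.
      have key : ∀ k l : ℝ, 0 < k → Real.exp (a * c / 2) ≤ k * Real.exp (a * l) →
          excess Player.max b θ (π n) * k ≤ excess Player.max b θ (π (n + 1)) →
          G.level Player.max Q (π n) + l ≤ G.level Player.max Q (π (n + 1)) →
          0 < excess Player.max b θ (π (n + 1)) ∧
          excess Player.max b θ (π n) * Real.exp (a * G.level Player.max Q (π n)) *
            Real.exp (a * c / 2) ≤
          excess Player.max b θ (π (n + 1)) * Real.exp (a * G.level Player.max Q (π (n + 1))) := by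
        intro k l hk h1 h2 h3
        refine ⟨(mul_pos hpos hk).trans_le h2, ?_⟩
        calc excess Player.max b θ (π n) * Real.exp (a * G.level Player.max Q (π n)) *
              Real.exp (a * c / 2)
            ≤ excess Player.max b θ (π n) * Real.exp (a * G.level Player.max Q (π n)) *
              (k * Real.exp (a * l)) := by gcongr
          _ = excess Player.max b θ (π n) * k *
              Real.exp (a * (G.level Player.max Q (π n) + l)) := by
            rw [mul_add, Real.exp_add]; ring
          _ ≤ _ := by
            have := ((mul_pos hpos hk).trans_le h2).le
            gcongr
      -- `1 + y ≤ exp y` turns the first-order balance into the exponential one; the second-order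
      -- error `(a * s) ^ 2` is paid for by half of the drift.
      have hexp : ∀ k y : ℝ, 0 ≤ k → 1 ≤ k * (1 + y) →
          Real.exp (a * c / 2) ≤ k * Real.exp (a * c / 2 + y) := fun k y hk h => by
        have h1 : 1 ≤ k * Real.exp y :=
          h.trans (mul_le_mul_of_nonneg_left (by linarith [Real.add_one_le_exp y]) hk)
        rw [Real.exp_add]
        nlinarith [Real.exp_pos (a * c / 2)]
      rcases hcases with ⟨h1, h2⟩ | ⟨h1, h2⟩ | ⟨h1, h2⟩
      · refine key (1 - a * s (π n).last) (c + s (π n).last) (by linarith) ?_ h1.ge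
          (by linarith)
        have e : a * (c + s (π n).last) = a * c / 2 + (a * c / 2 + a * s (π n).last) := by ring
        rw [e]
        exact hexp _ _ (by linarith) (by nlinarith)
      · refine key (1 + a * s (π n).last) (c - s (π n).last) (by linarith) ?_ h1 (by linarith)
        have e : a * (c - s (π n).last) = a * c / 2 + (a * c / 2 - a * s (π n).last) := by ring
        rw [e]
        exact hexp _ _ (by linarith) (by nlinarith)
      · refine key (1 + ε) (-L) (by linarith) ?_ (by nlinarith) (by linarith)
        rw [← Real.exp_log (by linarith : 0 < 1 + ε), ← Real.exp_add]
        exact Real.exp_le_exp.2 (by linarith)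
  refine le_meanPayoff (D := Real.log (excess Player.max b θ (π 0)) / a +
    G.level Player.max Q (π 0) - D) (by positivity) fun n => ?_
  obtain ⟨hpos, hn⟩ := hinv n
  have hδ1 : excess Player.max b θ (π n) ≤ 1 := (hround n hpos).1
  have h1 : Real.log (excess Player.max b θ (π 0)) + a * G.level Player.max Q (π 0) +
      a * c / 2 * n ≤ a * G.level Player.max Q (π n) := by
    rw [← Real.exp_le_exp, Real.exp_add, Real.exp_add, Real.exp_log h0]
    exact hn.trans (mul_le_of_le_one_left (Real.exp_pos _).le hδ1)
  have h2 : Real.log (excess Player.max b θ (π 0)) / a + G.level Player.max Q (π 0) + c / 2 * n ≤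
      G.level Player.max Q (π n) := by
    refine le_of_mul_le_mul_left (le_trans (le_of_eq ?_) h1) ha
    field_simp
  have h3 : G.level Player.max Q (π n) = (π n).energy G + Q (π n).last := by
    simp [level, Player.sign]
  have h4 := (abs_le.1 (hD (π n).last)).2
  linarith

open Filter in
/-- Without a drift, the proportion is chosen inversely to `A - level` whenever the level is
negative. As long as it stays negative, `excess / (A - level)` does not decrease, so that the level is
bounded from below. -/
theorem Guide.exists_guarantees_min
    (hG : G.Guide (fun v => Player.min.sign * G.weight v) θ Q 0 m hi) (τ : TieBreak V) (v : V)
    (b : ℝ) (hb : θ v < b) :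
    ∃ f : Strategy V, G.Guarantees τ Player.min b v f (Set.Iic 0) := by
  set s := surplus (fun v => Player.min.sign * G.weight v) Q 0 m with hs
  obtain ⟨ε, hε, hgap⟩ := exists_gap θ
  obtain ⟨L, hL0, hL⟩ := exists_loss_bound (fun v => Player.min.sign * G.weight v) Q
  obtain ⟨S, hS0, hS⟩ := exists_forall_abs_le s
  obtain ⟨D, hD0, hD⟩ := exists_forall_abs_le Q
  -- The first bound on `A` keeps the share of the excess that is bid below `1`; by the second one, a
  -- gain of `ε` in excess makes up for a loss of `L` in level.
  obtain ⟨A, hAS, hAL⟩ : ∃ A : ℝ, S + 1 ≤ A ∧ L ≤ ε * A :=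
    ⟨max (S + 1) (L / ε), le_max_left _ _, by
      rw [← div_le_iff₀' hε]; exact le_max_right _ _⟩
  let r : History V → ℝ := fun h => A + max 0 (-G.level Player.min Q h)
  have hrA : ∀ h, A ≤ r h := fun h => le_add_of_nonneg_right (le_max_left _ _)
  have hr0 : ∀ h, 0 < r h := fun h => by linarith [hrA h]
  have hsS : ∀ v, s v ≤ S := fun v => (le_abs_self _).trans (hS v)
  let f := guided Player.min b θ s m fun h => (r h)⁻¹
  refine ⟨f, legal_guided ((hG.theta_mem v).1.trans hb.le) hG.adj s _, fun g hg => ?_⟩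
  set π := outcome τ v (profile Player.min f g) with hπ
  have has : ∀ h, (r h)⁻¹ * s h.last < 1 := fun h => by
    rw [inv_mul_lt_one₀ (hr0 h)]
    linarith [hrA h, hsS h.last]
  have hround := hG.round_cases hs hgap hL (a := fun h => (r h)⁻¹) (fun h => (inv_pos.2 (hr0 h)).le)
    has hπ hg
  have hpos : ∀ n, 0 < excess Player.min b θ (π n) := fun n => by
    induction n with
    | zero =>
      have : excess Player.min b θ (π 0) = b - θ v := by
        simp [π, outcome, excess, budget_start, History.last]
      linarith
    | succ n ih =>
      obtain ⟨-, hs0, hcases⟩ := hround n ih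
      have hz : 0 ≤ (r (π n))⁻¹ * s (π n).last := mul_nonneg (inv_pos.2 (hr0 _)).le hs0
      rcases hcases with ⟨h1, -⟩ | ⟨h1, -⟩ | ⟨h1, -⟩
      · exact (mul_pos ih (sub_pos.2 (has (π n)))).trans_eq h1.symm
      · exact (mul_pos ih (by linarith)).trans_le h1
      · exact (by linarith : 0 < excess Player.min b θ (π n) + ε).trans_le h1
  have hlevel : ∀ n, ((π n).energy G : ℝ) ≤ D - G.level Player.min Q (π n) := fun n => by
    have := (abs_le.1 (hD (π n).last)).2
    simp only [level, Player.sign]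
    linarith
  by_cases hfreq : ∃ᶠ n in atTop, 0 ≤ G.level Player.min Q (π n)
  · exact meanPayoff_nonpos (C := D) (hfreq.mono fun n hn => (hlevel n).trans (by linarith))
  · rw [not_frequently, eventually_atTop] at hfreq
    obtain ⟨N, hN⟩ := hfreq
    have hr : ∀ n ≥ N, r (π n) = A - G.level Player.min Q (π n) := fun n hn => by
      have := not_le.1 (hN n hn)
      simp only [r]
      rw [max_eq_right (by linarith)]
      ring
    obtain ⟨κ, hκ0, hκ⟩ : ∃ κ : ℝ, 0 < κ ∧ κ * r (π N) = excess Player.min b θ (π N) :=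
      ⟨excess Player.min b θ (π N) / r (π N), div_pos (hpos N) (hr0 _),
        div_mul_cancel₀ _ (hr0 _).ne'⟩
    have hκL : κ * L ≤ ε := by
      have h1 : excess Player.min b θ (π N) ≤ 1 := (hround N (hpos N)).1
      have h2 : κ * A ≤ 1 := by
        rw [← hκ] at h1
        exact (mul_le_mul_of_nonneg_left (hrA _) hκ0.le).trans h1
      calc κ * L ≤ κ * (ε * A) := mul_le_mul_of_nonneg_left hAL hκ0.le
        _ = ε * (κ * A) := by ring
        _ ≤ ε := mul_le_of_le_one_right hε.le h2
    have hinv : ∀ n ≥ N, κ * r (π n) ≤ excess Player.min b θ (π n) := fun n hn => by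
      induction n, hn using Nat.le_induction with
      | base => exact hκ.le
      | succ n hn ih =>
        obtain ⟨-, hs0, hcases⟩ := hround n (hpos n)
        have hrn := hr n hn
        have hrn' := hr (n + 1) (by omega)
        have hrpos := hr0 (π n)
        have hmul : ∀ k : ℝ, 0 ≤ k → κ * (r (π n) * k) ≤ excess Player.min b θ (π n) * k :=
          fun k hk => by rw [← mul_assoc]; exact mul_le_mul_of_nonneg_right ih hk
        have hz0 : 0 ≤ (r (π n))⁻¹ * s (π n).last := mul_nonneg (inv_pos.2 hrpos).le hs0
        rcases hcases with ⟨h1, h2⟩ | ⟨h1, h2⟩ | ⟨h1, h2⟩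
        · have h3 := hmul (1 - (r (π n))⁻¹ * s (π n).last) (sub_pos.2 (has (π n))).le
          have h4 : r (π (n + 1)) = r (π n) * (1 - (r (π n))⁻¹ * s (π n).last) := by
            rw [mul_sub, mul_inv_cancel_left₀ hrpos.ne', hrn', hrn]
            rw [h2]; ring
          rw [h4]
          exact h3.trans h1.ge
        · have h3 := hmul (1 + (r (π n))⁻¹ * s (π n).last) (by linarith)
          have h4 : r (π (n + 1)) ≤ r (π n) * (1 + (r (π n))⁻¹ * s (π n).last) := by
            rw [mul_add, mul_inv_cancel_left₀ hrpos.ne', hrn', hrn]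
            linarith
          exact (mul_le_mul_of_nonneg_left h4 hκ0.le).trans (h3.trans h1)
        · have h4 : r (π (n + 1)) ≤ r (π n) + L := by
            rw [hrn', hrn]
            linarith
          have h5 := mul_le_mul_of_nonneg_left h4 hκ0.le
          rw [mul_add] at h5
          linarith
    refine meanPayoff_nonpos (C := D + κ⁻¹) (Eventually.frequently ?_)
    filter_upwards [eventually_ge_atTop N] with n hn
    have h1 : excess Player.min b θ (π n) ≤ 1 := (hround n (hpos n)).1
    have h2 : r (π n) ≤ κ⁻¹ := by
      rw [← one_div, le_div_iff₀' hκ0]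
      exact (hinv n hn).trans h1
    rw [hr n hn] at h2
    linarith [hlevel n]

end Game

end Bidding

/-! ### Uniqueness of the threshold and memoryless strategies -/

namespace Bidding

theorem initialBudget_min_eq (b : ℝ) :
    initialBudget Player.min b = initialBudget Player.max (1 - b) := by
  funext Q
  cases Q <;> simp [initialBudget]

theorem profile_min_eq {V : Type*} (f g : Strategy V) :
    profile Player.min f g = profile Player.max g f := by
  funext Q
  cases Q <;> simp [profile]

namespace Game

variable {V : Type*} {G : Game V}

theorem permitted_min_eq (b : ℝ) (Q : Player) (h : History V) (a : Action V) :
    G.Permitted Player.min b Q h a ↔ G.Permitted Player.max (1 - b) Q h a := by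
  simp only [Permitted, budget, initialBudget_min_eq]

/-- The two players cannot both reach their goals when their initial budgets sum to `1`: the
strategies can be played against each other. -/
theorem Guarantees.inter_nonempty {τ : TieBreak V} {v : V} {b : ℝ} {f g : Strategy V} {S S' : Set ℝ}
    (hf : G.Guarantees τ Player.min b v f S) (hg : G.Guarantees τ Player.max (1 - b) v g S') :
    (S ∩ S').Nonempty := by
  set π := outcome τ v (profile Player.max g f) with hπ
  have hπ' : outcome τ v (profile Player.min f g) = π := by rw [profile_min_eq]
  have hf1 : ∀ n, (∀ k < n, G.Permitted Player.max (1 - b) Player.max (π k) (g (π k))) →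
      G.Permitted Player.max (1 - b) Player.min (π n) (f (π n)) := fun n h => by
    have := hf.1 v g n
    rw [hπ'] at this
    rw [← permitted_min_eq]
    refine this fun Q hQ k hk => ?_
    rw [permitted_min_eq]
    cases Q
    · exact absurd rfl hQ
    · exact h k hk
  have hg1 : ∀ n, (∀ k < n, G.Permitted Player.max (1 - b) Player.min (π k) (f (π k))) →
      G.Permitted Player.max (1 - b) Player.max (π n) (g (π n)) := fun n h =>
    hg.1 v f n fun Q hQ k hk => by
      cases Q
      · exact h k hk
      · exact absurd rfl hQ
  have hboth : ∀ n, G.Permitted Player.max (1 - b) Player.min (π n) (f (π n)) ∧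
      G.Permitted Player.max (1 - b) Player.max (π n) (g (π n)) := fun n => by
    induction n using Nat.strong_induction_on with
    | _ n ih => exact ⟨hf1 n fun k hk => (ih k hk).2, hg1 n fun k hk => (ih k hk).1⟩
  refine ⟨G.meanPayoff π, ?_, hg.2 f fun Q hQ n => ?_⟩
  · have := hf.2 g
    rw [hπ'] at this
    refine this fun Q hQ n => ?_
    rw [permitted_min_eq]
    cases Q
    · exact absurd rfl hQ
    · exact (hboth n).2
  · cases Q
    · exact (hboth n).1
    · exact absurd rfl hQ

theorem IsThreshold.le {τ : TieBreak V} {v : V} {t t' : ℝ} (ht : G.IsThreshold τ v t)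
    (ht' : G.IsThreshold τ v t') : t' ≤ t := by
  by_contra! hlt
  obtain ⟨b, hb, hb'⟩ := exists_between hlt
  obtain ⟨f, hf⟩ := ht.2.1 b hb (hb'.le.trans ht'.1.2)
  obtain ⟨g, hg⟩ := ht'.2.2 (1 - b) (by linarith) (by linarith [ht.1.1])
  obtain ⟨x, hx, hx'⟩ := hf.inter_nonempty hg
  exact (Set.mem_Ioi.1 hx').not_ge hx

end Game

section Memory

variable {V : Type*} {G : Game V}

theorem isSelection_min (p : MvPolynomial (Fin 2) ℝ) :
    IsSelection 2 fun x e => min (MvPolynomial.eval ![x, e] p) x :=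
  IsSelection.select 1 1 (MvPolynomial.X 0 - p) _ _ _ (IsSelection.poly p)
    (IsSelection.poly (MvPolynomial.X 0)) (fun x e h => min_eq_left (by simpa using h))
    (fun x e h => by
      have h' : x ≤ MvPolynomial.eval ![x, e] p := by simpa using h.le
      simpa using h')

theorem isSelection_clamp (p : MvPolynomial (Fin 2) ℝ) :
    IsSelection 4 fun x e => min (max 0 (MvPolynomial.eval ![x, e] p)) x :=
  IsSelection.select 2 2 p _ _ _ (isSelection_min p) (isSelection_min 0)
    (fun x e h => by rw [max_eq_right h]) (fun x e h => by rw [max_eq_left h.le, map_zero])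

/-- The strategy `guided` with a constant proportion as a strategy with `n` memory states, of which
it uses only one. -/
noncomputable def guidedMemory {m : V → V} (hm : ∀ v, G.Adj v (m v)) (θ s : V → ℝ) (a : ℝ) {n : ℕ}
    (i : Fin n) : MemoryStrategy G n 4 where
  init := i
  update _ _ _ _ := i
  move _ := m
  move_adj _ := hm
  bid _ v x _ := Game.guidedBid θ s m a v x
  bid_mem _ _ x hx _ := ⟨le_min (le_max_left _ _) hx.1, (min_le_right _ _).trans hx.2⟩
  bid_simple _ v := ⟨4, le_rfl, by
    convert isSelection_clamp (MvPolynomial.C (θ v - θ (m v)) +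
      MvPolynomial.C (a * s v) * (MvPolynomial.X 0 - MvPolynomial.C (θ v))) using 1
    funext x e
    simp [Game.guidedBid]⟩

end Memory

end Bidding

theorem mainTheorem2 :
    ∃ K : ℕ, ∀ (V : Type*) [Finite V] (G : Bidding.Game V) (τ : Bidding.TieBreak V) (v : V),
      (∃! t : ℝ, G.IsThreshold τ v t) ∧
      ∀ t : ℝ, G.IsThreshold τ v t → ∀ B : ℝ, 1 - t < B → B ≤ 1 →
        (∃ s : Bidding.MemoryStrategy G K K, ∃ μ : ℝ, 0 < μ ∧
          G.Guarantees τ Bidding.Player.max B v (s.toStrategy Bidding.Player.max B)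
            (Set.Ici μ)) ∧
        (G.RecurrentSCC →
          ∃ s : Bidding.MemoryStrategy G 1 K, ∃ μ : ℝ, 0 < μ ∧
            G.Guarantees τ Bidding.Player.max B v (s.toStrategy Bidding.Player.max B)
              (Set.Ici μ)) := by
  refine ⟨4, fun V _ G τ v => ?_⟩
  obtain ⟨t, h, c, hc, ht, hmean, hbot⟩ :=
    Bidding.Game.exists_threshold_function (G := G) fun v => (G.weight v : ℝ)
  obtain ⟨Q, m, hi, hmax⟩ := Bidding.Game.exists_guide (G := G)
    (g := fun v => Bidding.Player.max.sign * G.weight v) (θ := fun v => 1 - t v) (h := h) hc.le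
    (fun v => ⟨by linarith [(ht v).2], by linarith [(ht v).1]⟩) (fun v => (hmean v).const_sub 1)
    (fun v hv => by
      rcases hbot v hv with ⟨h1, r, hr, hm⟩ | ⟨h0, -⟩
      · exact Or.inr ⟨by linarith, r, hr, by simpa [Bidding.Player.sign] using hm⟩
      · exact Or.inl (by linarith))
  obtain ⟨Q', m', hi', hmin⟩ := Bidding.Game.exists_guide (G := G)
    (g := fun v => Bidding.Player.min.sign * G.weight v) (θ := t) (h := fun v => 0 - h v) le_rfl
    ht hmean
    (fun v hv => by
      rcases hbot v hv with ⟨h1, -⟩ | ⟨h0, r, hr, hm⟩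
      · exact Or.inl h1
      · refine Or.inr ⟨h0, -r, by linarith, ?_⟩
        convert hm.const_sub 0 using 1
        simp only [Bidding.Player.sign]
        ring)
  obtain ⟨a, ha⟩ := hmax.exists_guarantees_max hc
  have hthr : G.IsThreshold τ v (t v) := by
    refine ⟨ht v, fun b hb _ => hmin.exists_guarantees_min τ v b hb, fun b hb _ =>
      ⟨_, (ha τ v b hb).1, fun g hg => ?_⟩⟩
    exact (by positivity : 0 < c / 4).trans_le ((ha τ v b hb).2 g hg)
  refine ⟨⟨t v, hthr, fun t' ht' => le_antisymm (hthr.le ht') (ht'.le hthr)⟩,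
    fun t' ht' B hB _ => ?_⟩
  have hB' : 1 - t v < B := by linarith [hthr.le ht']
  -- A single memory state suffices whether or not the graph is recurrent.
  have hstrat : ∀ {n : ℕ} (_ : Fin n), ∃ s : Bidding.MemoryStrategy G n 4, ∃ μ : ℝ, 0 < μ ∧
      G.Guarantees τ Bidding.Player.max B v (s.toStrategy Bidding.Player.max B) (Set.Ici μ) :=
    fun i => ⟨Bidding.guidedMemory hmax.adj (fun v => 1 - t v)
      (Bidding.Game.surplus (fun v => Bidding.Player.max.sign * G.weight v) Q c m) a i,
      c / 4, by positivity, ha τ v B hB'⟩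
  exact ⟨hstrat (n := 4) 0, fun _ => hstrat (n := 1) 0⟩
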